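/- For an integer $j\ge 0$ let $\binom{x}{j}=\frac{x(x-1)\cdots(x-j+1)}{j!}\in\mathbb{Q}[x]$. For an integer $m\ge 0$ put $$P_m(x)=\sum_{i=0}^{m}\sum_{j=0}^{m}\binom{x+j}{j}\binom{x-1}{j}\binom{j}{i}\binom{m}{i}\binom{i}{m-j}\frac{3}{(2i-1)(2j+1)(2m-2i-1)}\in\mathbb{Q}[x],$$ and for an integer $k\ge 0$ put $$B_k(x)=\binom{x+k}{2k}+\binom{-x+k}{2k}.$$ For $m,k\ge 0$ let $d(m,k)\in\mathbb{Q}$ be the coefficients in the unique expansion $P_m(x)=\sum_{k\ge0} d(m,k)B_k(x)$ as a finite sum, and put $d(m,k)=0$ if $m<0$ or $k<0$. Then for all integers $m$ and $k$, the number $m(m-1)(2m+1)\,d(m,k)$ is an integer multiple of $3m(m-1)$; that is, there is an integer $n$ with $$m(m-1)(2m+1)\,d(m,k)=3m(m-1)\,n.$$ -/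

import Mathlib

open Polynomial

noncomputable section

namespace KevinPoly

/-- The binomial coefficient `binom(X, j)` as a polynomial in `X` over `ℚ`. -/
def binomPoly (j : ℕ) : ℚ[X] := C ((j.factorial : ℚ)⁻¹) * descPochhammer ℚ j

/-- `P m` is the polynomial
`∑_{i=0}^m ∑_{j=0}^m binom(x+j,j) binom(x-1,j) binom(j,i) binom(m,i) binom(i,m-j)`
`· 3 / ((2i-1)(2j+1)(2m-2i-1))`; the subtraction in `m - j` is never truncated as `j ≤ m`. -/
def P (m : ℕ) : ℚ[X] :=
  ∑ i ∈ Finset.range (m + 1), ∑ j ∈ Finset.range (m + 1),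
    (binomPoly j).comp (X + C (j : ℚ)) * (binomPoly j).comp (X - 1) *
      C ((j.choose i : ℚ) * (m.choose i : ℚ) * (i.choose (m - j) : ℚ) *
        (3 / ((2 * (i : ℚ) - 1) * (2 * (j : ℚ) + 1) * (2 * (m : ℚ) - 2 * (i : ℚ) - 1))))

/-- `B k = binom(x+k, 2k) + binom(-x+k, 2k)`. -/
def B (k : ℕ) : ℚ[X] :=
  (binomPoly (2 * k)).comp (X + C (k : ℚ)) + (binomPoly (2 * k)).comp (-X + C (k : ℚ))

/-- `c` is the family of coefficients of `P m` in terms of the `B k`: `P m = ∑_k c k * B k`. -/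
def IsExpansion (m : ℕ) (c : ℕ →₀ ℚ) : Prop :=
  P m = c.sum fun k a => C a * B k

/-- The closed formula for the coefficients of `P m` in terms of the `B k`. -/
def explicitCoeff (m k : ℕ) : ℚ :=
  ∑ i ∈ Finset.range (m + 1), ∑ j ∈ Finset.Icc k m,
    3 * (-1) ^ (k + j) * ((2 * k).choose k : ℚ) * (j.choose i : ℚ) * (m.choose i : ℚ) *
      (i.choose (m - j) : ℚ) /
      (2 * (2 * (i : ℚ) - 1) * (2 * (j : ℚ) + 1) * (2 * (m : ℚ) - 2 * (i : ℚ) - 1))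

lemma desc_add (n : ℕ) (a : ℚ) :
    (descPochhammer ℚ (n + 1)).comp (X + C (a + 1)) =
      (X + C (a + 1)) * (descPochhammer ℚ n).comp (X + C a) := by
  rw [descPochhammer_succ_left, mul_comp, X_comp, comp_assoc]
  congr 2
  simp
  ring

/-- `∏_{l=1}^j (X² - l²)`. -/
def R (j : ℕ) : ℚ[X] := ∏ l ∈ Finset.range j, (X ^ 2 - C (((l : ℚ) + 1) ^ 2))

lemma desc_mul (j : ℕ) :
    (descPochhammer ℚ j).comp (X + C (j : ℚ)) * (descPochhammer ℚ j).comp (X - 1) = R j := by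
  induction j with
  | zero => simp [R]
  | succ j ih =>
    have h1 := desc_add j (j : ℚ)
    have h2 : (descPochhammer ℚ (j + 1)).comp (X - 1) =
        (descPochhammer ℚ j).comp (X - 1) * (X - 1 - C (j : ℚ)) := by
      rw [descPochhammer_succ_right, mul_comp]; simp
    have h3 : R (j + 1) = R j * (X ^ 2 - C (((j : ℚ) + 1) ^ 2)) := Finset.prod_range_succ _ _
    rw [Nat.cast_succ, h1, h2, h3, ← ih]
    simp only [map_add, map_pow, map_one]
    ring

lemma desc_two (j : ℕ) :
    (descPochhammer ℚ (2 * (j + 1))).comp (X + C ((j : ℚ) + 1)) =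
      R j * X * (X + C ((j : ℚ) + 1)) := by
  have key : ∀ j : ℕ, (descPochhammer ℚ (2 * (j + 1))).comp (X + C ((j : ℚ) + 1)) =
      (X + C ((j : ℚ) + 1)) * ((descPochhammer ℚ (2 * j)).comp (X + C (j : ℚ)) *
        (X - C (j : ℚ))) := by
    intro j
    rw [show 2 * (j + 1) = (2 * j + 1) + 1 by ring, desc_add, descPochhammer_succ_right, mul_comp]
    congr 2
    simp
    ring
  induction j with
  | zero => rw [key]; simp [R]; ring
  | succ j ih =>
    rw [key]
    push_cast
    rw [ih]
    have h3 : R (j + 1) = R j * (X ^ 2 - C (((j : ℚ) + 1) ^ 2)) := Finset.prod_range_succ _ _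
    rw [h3]
    simp only [map_add, map_pow, map_one]
    ring

lemma R_comp_neg (j : ℕ) : (R j).comp (-X) = R j := by
  simp [R, prod_comp]

lemma B_zero : B 0 = C 2 := by
  simp only [B, binomPoly]
  simp
  rw [map_ofNat]; norm_num

lemma B_succ (j : ℕ) :
    B (j + 1) = C (2 * (((2 * (j + 1)).factorial : ℚ))⁻¹) * (X ^ 2 * R j) := by
  have h := desc_two j
  have h' : (descPochhammer ℚ (2 * (j + 1))).comp (-X + C ((j : ℚ) + 1)) =
      R j * (-X) * (-X + C ((j : ℚ) + 1)) := by
    have := congrArg (fun p : ℚ[X] => p.comp (-X)) h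
    simp only [comp_assoc, mul_comp, add_comp, X_comp, C_comp, R_comp_neg] at this
    exact this
  simp only [B, binomPoly, mul_comp, C_comp]
  push_cast
  rw [h, h']
  simp only [map_mul, map_ofNat]
  ring

lemma binom_expand (j : ℕ) :
    (binomPoly j).comp (X + C (j : ℚ)) * (binomPoly j).comp (X - 1) =
      ∑ k ∈ Finset.range (j + 1), C ((-1) ^ (k + j) * ((2 * k).choose k : ℚ) / 2) * B k := by
  have hQ : ∀ j : ℕ, (binomPoly j).comp (X + C (j : ℚ)) * (binomPoly j).comp (X - 1) =
      C ((j.factorial : ℚ)⁻¹ ^ 2) * R j := by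
    intro j
    rw [← desc_mul]
    simp only [binomPoly, mul_comp, C_comp, map_pow]
    ring
  rw [hQ]
  induction j with
  | zero =>
    simp only [zero_add, Finset.sum_range_one, B_zero, R, Finset.prod_range_zero, ← C_mul]
    norm_num
  | succ j ih =>
    rw [Finset.sum_range_succ]
    have hs : ∑ k ∈ Finset.range (j + 1),
        C ((-1) ^ (k + (j + 1)) * ((2 * k).choose k : ℚ) / 2) * B k =
        - (C ((j.factorial : ℚ)⁻¹ ^ 2) * R j) := by
      rw [ih, ← Finset.sum_neg_distrib]
      refine Finset.sum_congr rfl fun k _ => ?_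
      rw [← neg_mul, ← C_neg]
      congr 2
      ring
    have h3 : R (j + 1) = R j * (X ^ 2 - C (((j : ℚ) + 1) ^ 2)) := Finset.prod_range_succ _ _
    have hf : ((2 * (j + 1)).choose (j + 1) : ℚ) =
        ((2 * (j + 1)).factorial : ℚ) * ((j + 1).factorial : ℚ)⁻¹ ^ 2 := by
      rw [Nat.cast_choose ℚ (by omega : j + 1 ≤ 2 * (j + 1)),
        show 2 * (j + 1) - (j + 1) = j + 1 by omega]
      field_simp
    have hfac : (((2 * (j + 1)).factorial : ℕ) : ℚ) ≠ 0 := by positivity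
    have hj : (j.factorial : ℚ)⁻¹ ^ 2 = ((j + 1).factorial : ℚ)⁻¹ ^ 2 * ((j : ℚ) + 1) ^ 2 := by
      have : (j.factorial : ℚ) ≠ 0 := by positivity
      have : (j : ℚ) + 1 ≠ 0 := by positivity
      rw [Nat.factorial_succ]
      push_cast
      field_simp
    have hlast : C ((-1) ^ (j + 1 + (j + 1)) * ((2 * (j + 1)).choose (j + 1) : ℚ) / 2) *
        B (j + 1) = C (((j + 1).factorial : ℚ)⁻¹ ^ 2) * (X ^ 2 * R j) := by
      rw [B_succ, ← mul_assoc, ← C_mul, hf, Even.neg_one_pow ⟨j + 1, rfl⟩]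
      congr 2
      field_simp
    rw [hs, hlast, h3, hj, C_mul]
    ring

lemma B_eval_lt {k i : ℕ} (h : i < k) : (B k).eval (i : ℚ) = 0 := by
  obtain ⟨j, rfl⟩ : ∃ j, k = j + 1 := ⟨k - 1, by omega⟩
  rw [B_succ, eval_mul, eval_mul]
  rcases Nat.eq_zero_or_pos i with rfl | hi
  · simp
  · have : (R j).eval (i : ℚ) = 0 := by
      rw [R, eval_prod]
      refine Finset.prod_eq_zero (i := i - 1) (Finset.mem_range.2 (by omega)) ?_
      have : ((i - 1 : ℕ) : ℚ) + 1 = i := by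
        rw [Nat.cast_sub hi]; simp
      simp [this]
    rw [this]; simp

lemma B_eval_self (k : ℕ) : (B k).eval (k : ℚ) ≠ 0 := by
  rcases k with _ | j
  · simp [B_zero]
  · rw [B_succ, eval_mul, eval_mul, R, eval_prod, eval_C, eval_pow, eval_X]
    refine mul_ne_zero (by positivity) (mul_ne_zero (by positivity) ?_)
    refine Finset.prod_ne_zero_iff.2 fun l hl => ?_
    have hl' : (l : ℚ) < j := by exact_mod_cast Finset.mem_range.1 hl
    have hl0 : (0 : ℚ) ≤ l := by positivity
    simp only [eval_sub, eval_pow, eval_X, eval_C]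
    push_cast
    nlinarith

lemma sum_B_inj {c c' : ℕ →₀ ℚ}
    (h : (c.sum fun k a => C a * B k) = c'.sum fun k a => C a * B k) : c = c' := by
  rw [← sub_eq_zero]
  have h0 : ((c - c').sum fun k a => C a * B k) = 0 := by
    rw [Finsupp.sum_sub_index (by intros; simp [sub_mul]), h, sub_self]
  generalize c - c' = e at h0
  ext k
  induction k using Nat.strong_induction_on with
  | _ k ih =>
    have h1 := congrArg (eval (k : ℚ)) h0
    rw [Finsupp.sum, eval_finsetSum, Finset.sum_eq_single k] at h1
    · simpa [B_eval_self] using h1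
    · intro l _ hl
      rcases lt_or_gt_of_ne hl with h2 | h2
      · simp [ih l h2]
      · simp [B_eval_lt h2]
    · intro hk
      simp [Finsupp.notMem_support_iff.1 hk]

/-- The closed formula, as a finitely supported family. -/
def explicitFinsupp (m : ℕ) : ℕ →₀ ℚ :=
  Finsupp.onFinset (Finset.range (m + 1)) (explicitCoeff m) (by
    intro k hk
    by_contra h
    apply hk
    have : Finset.Icc k m = ∅ := Finset.Icc_eq_empty (by simpa using h)
    simp [explicitCoeff, this])

theorem isExpansion_explicit (m : ℕ) : IsExpansion m (explicitFinsupp m) := by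
  rw [IsExpansion, explicitFinsupp, Finsupp.onFinset_sum _ (by simp)]
  simp only [P, explicitCoeff, map_sum, Finset.sum_mul]
  refine Eq.trans ?_ Finset.sum_comm
  refine Finset.sum_congr rfl fun i _ => ?_
  simp_rw [binom_expand, Finset.sum_mul]
  rw [Finset.sum_sigma', Finset.sum_sigma']
  refine Finset.sum_bij' (fun p _ => ⟨p.2, p.1⟩) (fun p _ => ⟨p.2, p.1⟩) ?_ ?_ ?_ ?_ ?_
  · simp; omega
  · simp; omega
  · simp
  · simp
  · rintro ⟨j, k⟩ _
    rw [mul_right_comm, ← C_mul]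
    congr 2
    simp only [div_eq_mul_inv, mul_inv]
    ring

theorem existsUnique_isExpansion (m : ℕ) : ∃! c : ℕ →₀ ℚ, IsExpansion m c :=
  ⟨explicitFinsupp m, isExpansion_explicit m, fun _ hc =>
    sum_B_inj (hc.symm.trans (isExpansion_explicit m))⟩

/-- `d m k` for integers `m`, `k`: for `m, k ≥ 0` the coefficient of `B k` in the unique
expansion `P m = ∑_k d m k * B k`, and `0` if `m < 0` or `k < 0`. -/
def d (m k : ℤ) : ℚ :=
  if 0 ≤ m ∧ 0 ≤ k then (existsUnique_isExpansion m.toNat).choose k.toNat else 0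

/-- The coefficients `d m k` are given by the closed formula. -/
theorem d_natCast (m k : ℕ) : d m k = explicitCoeff m k := by
  have h := (existsUnique_isExpansion m).unique
    (existsUnique_isExpansion m).choose_spec.1 (isExpansion_explicit m)
  simp only [d, Int.natCast_nonneg, and_self, if_true, Int.toNat_natCast]
  rw [h]
  rfl

end KevinPoly

end

/-! Let S(m,j) be the sum over i in `d m k`. By the closed formula, `d m k` is 3/2 · binom(2k,k)
times the alternating sum over j ≥ k of S(m,j)/(2j+1). A recurrence linking S(m,k) to S(m,k+1)
collapses this sum: with m = k + c, multiplying it by 2m+1 leaves (1-2c) S(m,k) plus an explicit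
binomial term (`alternating_sum_innerSum`).

For m ≥ 2 two integrality facts remain. The explicit term is integral by partial fractions in
1/(m(m-1)). S(m,k) · binom(2k,k) is an even integer, term by term: each numerator is divisible by
binom(2i,i) · binom(2(m-i),m-i) (`centralBinom_mul_dvd`), which absorbs 2(2i-1)(2m-2i-1). For m = 0,
1 the factor m(m-1) vanishes. -/

namespace KevinPoly

/-! ### Coefficients of half-integer powers of 1 - 4x -/

/-- The coefficient of `x ^ p` in `(1 - 4 * x) ^ (-n - 1 / 2)`. -/
def halfCoeff (n p : ℕ) : ℚ :=
  ((2 * (n + p)).factorial : ℚ) * n.factorial / ((n + p).factorial * (2 * n).factorial * p.factorial)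

lemma halfCoeff_zero (n : ℕ) : halfCoeff n 0 = 1 := by
  have h1 : ((n.factorial : ℕ) : ℚ) ≠ 0 := by positivity
  have h2 : (((2 * n).factorial : ℕ) : ℚ) ≠ 0 := by positivity
  simp only [halfCoeff, add_zero, Nat.factorial_zero, Nat.cast_one]
  field_simp

/-- Compare coefficients in (1-4x) · (1-4x)^(-n-3/2) = (1-4x)^(-n-1/2). -/
lemma halfCoeff_succ_succ (n p : ℕ) :
    halfCoeff (n + 1) (p + 1) = 4 * halfCoeff (n + 1) p + halfCoeff n (p + 1) := by
  have h1 : ((n.factorial : ℕ) : ℚ) ≠ 0 := by positivity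
  have h2 : (((2 * n).factorial : ℕ) : ℚ) ≠ 0 := by positivity
  have h3 : ((p.factorial : ℕ) : ℚ) ≠ 0 := by positivity
  have h4 : (((n + p).factorial : ℕ) : ℚ) ≠ 0 := by positivity
  have h5 : (((2 * (n + p)).factorial : ℕ) : ℚ) ≠ 0 := by positivity
  rw [halfCoeff, halfCoeff, halfCoeff, show n + 1 + (p + 1) = n + p + 1 + 1 by ring,
    show n + 1 + p = n + p + 1 by ring, show n + (p + 1) = n + p + 1 by ring,
    show 2 * (n + p + 1 + 1) = 2 * (n + p) + 1 + 1 + 1 + 1 by ring,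
    show 2 * (n + p + 1) = 2 * (n + p) + 1 + 1 by ring, show 2 * (n + 1) = 2 * n + 1 + 1 by ring]
  simp only [Nat.factorial_succ]
  push_cast
  field_simp
  ring

/-- Expand (1-4x)^(-b) = (1 + 4x/(1-4x))^b by the binomial theorem and multiply by (1-4x)^(-c-1/2).
-/
lemma halfCoeff_add (b c a : ℕ) :
    halfCoeff (b + c) a =
      ∑ l ∈ Finset.range (a + 1), 4 ^ l * (b.choose l : ℚ) * halfCoeff (c + l) (a - l) := by
  induction b generalizing c a with
  | zero =>
    rw [Finset.sum_range_succ', Finset.sum_eq_zero (fun l _ => by simp)]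
    simp
  | succ b ih =>
    rcases a with _ | a
    · simp [halfCoeff_zero]
    -- Peeling off l = 0 aligns the two sums so that Pascal's rule merges them termwise.
    · rw [show b + 1 + c = b + c + 1 by ring, halfCoeff_succ_succ,
        show b + c + 1 = b + (c + 1) by ring, ih (c + 1) a, ih c (a + 1),
        Finset.sum_range_succ' _ (a + 1), Finset.sum_range_succ' _ (a + 1), Finset.mul_sum,
        ← add_assoc, ← Finset.sum_add_distrib]
      congr 1
      swap
      · simp
      refine Finset.sum_congr rfl fun l _ => ?_
      rw [Nat.choose_succ_succ, Nat.add_sub_add_right, show c + 1 + l = c + (l + 1) by ring]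
      push_cast
      ring

/-- Each term of `halfCoeff_add`, scaled by the factor needed in `centralBinom_mul_dvd`, has an
explicit product of binomials as quotient. -/
lemma halfCoeff_mul_integral (a b c l : ℕ) (hl : l ≤ a) : ∃ n : ℕ,
    (b.choose l : ℚ) * halfCoeff (c + l) (a - l) *
        (((2 * (b + c)).factorial : ℚ) * (a + b + 2 * c).factorial /
          (((b + c).factorial : ℚ) ^ 2 * (a + c).factorial * b.factorial * c.factorial)) =
      ((b + c).centralBinom : ℚ) * (a + c).centralBinom * n := by
  rcases lt_or_ge b l with hb | hb
  · exact ⟨0, by simp [Nat.choose_eq_zero_of_lt hb]⟩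
  obtain ⟨a, rfl⟩ := Nat.exists_eq_add_of_le hl
  obtain ⟨b, rfl⟩ := Nat.exists_eq_add_of_le hb
  refine ⟨(c + l).choose l * ((a + b + 2 * (c + l)).choose a * (b + 2 * (c + l)).choose b), ?_⟩
  have e1 : l + a + (l + b) + 2 * c = a + b + 2 * (c + l) := by ring
  have e2 : c + l + a = l + a + c := by ring
  have e3 : l + a - l = a := by omega
  have e4 : a + b + 2 * (c + l) = a + (b + 2 * (c + l)) := by ring
  rw [halfCoeff, e3, e1, e2, e4]
  push_cast
  rw [Nat.centralBinom_eq_two_mul_choose, Nat.centralBinom_eq_two_mul_choose,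
    show 2 * (l + b + c) = (l + b + c) + (l + b + c) by ring,
    show 2 * (l + a + c) = (l + a + c) + (l + a + c) by ring,
    add_comm c l, Nat.cast_add_choose, Nat.cast_add_choose, Nat.cast_add_choose,
    Nat.cast_add_choose, Nat.cast_add_choose, Nat.cast_add_choose]
  field_simp

/-! ### Divisors of central binomial coefficients -/

lemma two_mul_sub_one_dvd_centralBinom (i : ℕ) (hi : i ≠ 0) :
    ∃ n : ℤ, (i.centralBinom : ℤ) = 2 * ((2 * i - 1) * n) := by
  obtain ⟨j, rfl⟩ := Nat.exists_eq_succ_of_ne_zero hi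
  -- binom(2j+2, j+1) = 2(2j+1) · Catalan(j).
  refine ⟨catalan j, ?_⟩
  have h := Nat.succ_mul_centralBinom_succ j
  rw [← succ_mul_catalan_eq_centralBinom j] at h
  have h' : (j + 1).centralBinom = 2 * ((2 * j + 1) * catalan j) :=
    Nat.eq_of_mul_eq_mul_left (Nat.succ_pos j) (by rw [Nat.succ_eq_add_one, h]; ring)
  rw [Nat.succ_eq_add_one, h']
  push_cast
  ring

lemma two_mul_sub_one_ne_zero (i : ℕ) : 2 * (i : ℚ) - 1 ≠ 0 := by
  intro h
  have : (2 * (i : ℤ) - 1 : ℤ) = 0 := by exact_mod_cast h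
  omega

lemma two_mul_sub_one_dvd_centralBinom_all (i : ℕ) :
    ∃ n : ℤ, (i.centralBinom : ℚ) = (2 * i - 1) * n := by
  rcases eq_or_ne i 0 with rfl | hi
  · exact ⟨-1, by simp⟩
  · obtain ⟨n, hn⟩ := two_mul_sub_one_dvd_centralBinom i hi
    refine ⟨2 * n, ?_⟩
    have : (i.centralBinom : ℚ) = 2 * ((2 * i - 1) * n) := by exact_mod_cast hn
    rw [this]
    push_cast
    ring

lemma two_mul_sub_one_mul_dvd_centralBinom_mul (i i' : ℕ) (h : i ≠ 0 ∨ i' ≠ 0) :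
    ∃ n : ℤ, (i.centralBinom : ℚ) * i'.centralBinom =
      2 * ((2 * i - 1) * (2 * i' - 1)) * n := by
  wlog hi : i ≠ 0 generalizing i i'
  · obtain ⟨n, hn⟩ := this i' i h.symm (h.resolve_left hi)
    exact ⟨n, by rw [mul_comm, hn]; ring⟩
  obtain ⟨n, hn⟩ := two_mul_sub_one_dvd_centralBinom i hi
  obtain ⟨n', hn'⟩ := two_mul_sub_one_dvd_centralBinom_all i'
  have hn : (i.centralBinom : ℚ) = 2 * ((2 * i - 1) * n) := by exact_mod_cast hn
  refine ⟨n * n', ?_⟩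
  rw [hn, hn']
  push_cast
  ring

/-- With i = b+c, k = a+b+c and m = a+b+2c, the left side is the numerator of the i-th term of
S(m,k) · binom(2k,k), and m-i = a+c. It is a multiple of `halfCoeff (b + c) a`, whose expansion is
integral termwise. -/
lemma centralBinom_mul_dvd (a b c : ℕ) : ∃ n : ℕ,
    ((a + b + c).choose (b + c) : ℚ) * (a + b + 2 * c).choose (b + c) * (b + c).choose c *
        (a + b + c).centralBinom = ((b + c).centralBinom : ℚ) * (a + c).centralBinom * n := by
  choose! n hn using halfCoeff_mul_integral a b c
  refine ⟨∑ l ∈ Finset.range (a + 1), 4 ^ l * n l, ?_⟩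
  have e1 : a + b + c = b + c + a := by ring
  have e2 : a + b + 2 * c = (b + c) + (a + c) := by ring
  have key : ((a + b + c).choose (b + c) : ℚ) * (a + b + 2 * c).choose (b + c) * (b + c).choose c *
        (a + b + c).centralBinom = halfCoeff (b + c) a *
          (((2 * (b + c)).factorial : ℚ) * (a + b + 2 * c).factorial /
          (((b + c).factorial : ℚ) ^ 2 * (a + c).factorial * b.factorial * c.factorial)) := by
    rw [halfCoeff, e1, e2, Nat.centralBinom_eq_two_mul_choose,
      show 2 * (b + c + a) = (b + c + a) + (b + c + a) by ring, Nat.cast_add_choose,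
      Nat.cast_add_choose, Nat.cast_add_choose, add_comm b c, Nat.cast_add_choose]
    field_simp
  rw [key, halfCoeff_add, Finset.sum_mul]
  push_cast
  rw [Finset.mul_sum]
  refine Finset.sum_congr rfl fun l hl => ?_
  have := hn l (Nat.lt_succ_iff.1 (Finset.mem_range.1 hl))
  linear_combination 4 ^ l * this

/-! ### The inner sum over i and its recurrence -/

/-- `binom(j,i) * binom(m,i) * binom(i,m-j)`. -/
def tripleChoose (m j i : ℕ) : ℚ := (j.choose i : ℚ) * m.choose i * i.choose (m - j)

/-- `∑_i binom(j,i) * binom(m,i) * binom(i,m-j) / ((2i-1)(2m-2i-1))`. -/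
def innerSum (m j : ℕ) : ℚ :=
  ∑ i ∈ Finset.range (m + 1), tripleChoose m j i / ((2 * i - 1) * (2 * m - 2 * i - 1))

/-- Trinomial revision pulls out binom(j, m-j); Vandermonde for 2j = m + (2j-m) sums the rest. -/
lemma sum_tripleChoose (m j : ℕ) (h : j ≤ m) :
    ∑ i ∈ Finset.range (m + 1), tripleChoose m j i = (j.choose (m - j) : ℚ) * j.centralBinom := by
  rcases lt_or_ge j (m - j) with hj | hj
  · rw [Nat.choose_eq_zero_of_lt hj, Nat.cast_zero, zero_mul]
    refine Finset.sum_eq_zero fun i _ => ?_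
    rcases lt_or_ge j i with hi | hi
    · simp [tripleChoose, Nat.choose_eq_zero_of_lt hi]
    · simp [tripleChoose, Nat.choose_eq_zero_of_lt (hi.trans_lt hj)]
  have hv : j.centralBinom = ∑ i ∈ Finset.range (j + 1),
      m.choose i * (j - (m - j)).choose (j - i) := by
    rw [Nat.centralBinom_eq_two_mul_choose, show 2 * j = m + (j - (m - j)) by omega,
      Nat.add_choose_eq, Finset.Nat.sum_antidiagonal_eq_sum_range_succ_mk]
  rw [hv, ← Finset.sum_subset (Finset.range_mono (Nat.succ_le_succ h))]
  · push_cast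
    rw [Finset.mul_sum]
    refine Finset.sum_congr rfl fun i hi => ?_
    have hi' : i ≤ j := Nat.lt_succ_iff.1 (Finset.mem_range.1 hi)
    rcases lt_or_ge i (m - j) with hc | hc
    · have : j - (m - j) < j - i := by omega
      simp [tripleChoose, Nat.choose_eq_zero_of_lt hc, Nat.choose_eq_zero_of_lt this]
    · have h1 := Nat.choose_mul (n := j) hc
      have h2 : (j - (m - j)).choose (j - i) = (j - (m - j)).choose (i - (m - j)) := by
        rw [← Nat.choose_symm (by omega : i - (m - j) ≤ j - (m - j))]
        congr 1
        omega
      have h1' : (j.choose i : ℚ) * i.choose (m - j) =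
        j.choose (m - j) * (j - (m - j)).choose (i - (m - j)) := by exact_mod_cast h1
      rw [tripleChoose, h2]
      linear_combination (m.choose i : ℚ) * h1'
  · intro i _ hi
    simp [tripleChoose, Nat.choose_eq_zero_of_lt (by simpa using hi : j < i)]

lemma choose_succ_mul_sub (n i : ℕ) :
    ((n + 1).choose i : ℚ) * (n + 1 - i) = (n + 1) * n.choose i := by
  rcases le_or_gt i (n + 1) with h | h
  · have := Nat.choose_mul_succ_eq n i
    have h' : ((n.choose i : ℕ) : ℚ) * (n + 1) = (n + 1).choose i * ((n + 1 - i : ℕ) : ℚ) := by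
      exact_mod_cast this
    rw [Nat.cast_sub h] at h'
    push_cast at h'
    linear_combination -h'
  · simp [Nat.choose_eq_zero_of_lt h, Nat.choose_eq_zero_of_lt (by omega : n < i)]

lemma choose_succ_right_mul (i c : ℕ) :
    (i.choose (c + 1) : ℚ) * (c + 1) = i.choose c * (i - c) := by
  rcases le_or_gt c i with h | h
  · have := Nat.choose_succ_right_eq i c
    have h' : (i.choose (c + 1) : ℚ) * (c + 1) = i.choose c * ((i - c : ℕ) : ℚ) := by
      exact_mod_cast this
    rwa [Nat.cast_sub h] at h'
  · simp [Nat.choose_eq_zero_of_lt h, Nat.choose_eq_zero_of_lt (by omega : i < c + 1)]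

lemma tripleChoose_succ (k c i : ℕ) :
    tripleChoose (k + (c + 1)) (k + 1) i * ((k + 1 - i) * (i - c)) =
      (k + 1) * (c + 1) * tripleChoose (k + (c + 1)) k i := by
  have h1 := choose_succ_mul_sub k i
  have h2 := choose_succ_right_mul i c
  simp only [tripleChoose, show k + (c + 1) - (k + 1) = c by omega,
    show k + (c + 1) - k = c + 1 by omega]
  linear_combination ((k + (c + 1)).choose i : ℚ) * (i.choose c * (i - c) * h1 -
    (k + 1) * k.choose i * h2)

/-- For m = k+c+1, 4(k+1-i)(i-c) = (2i-1)(2m-2i-1) + (2k+1)(1-2c). Lowering j from k+1 to k brings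
in the left side; on the right, the first summand cancels the denominator and leaves
`sum_tripleChoose`. -/
lemma innerSum_succ (k c : ℕ) :
    4 * (c + 1) * (k + 1) * innerSum (k + (c + 1)) k =
      (2 * k + 1) * (1 - 2 * c) * innerSum (k + (c + 1)) (k + 1) +
        ((k + 1).choose c : ℚ) * (k + 1).centralBinom := by
  have h := sum_tripleChoose (k + (c + 1)) (k + 1) (by omega)
  rw [show k + (c + 1) - (k + 1) = c by omega] at h
  rw [← h, innerSum, innerSum, Finset.mul_sum, Finset.mul_sum, ← Finset.sum_add_distrib]
  refine Finset.sum_congr rfl fun i hi => ?_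
  have hi' : i ≤ k + (c + 1) := Nat.lt_succ_iff.1 (Finset.mem_range.1 hi)
  have h1 := two_mul_sub_one_ne_zero i
  have h2 := two_mul_sub_one_ne_zero (k + (c + 1) - i)
  rw [Nat.cast_sub hi', mul_sub] at h2
  have h3 := tripleChoose_succ k c i
  push_cast at h2 ⊢
  rw [← mul_div_assoc, ← mul_div_assoc, div_add' _ _ _ (mul_ne_zero h1 h2),
    div_left_inj' (mul_ne_zero h1 h2)]
  linear_combination -4 * h3

/-! ### Collapsing the alternating sum over j -/

lemma alternating_sum_innerSum (k c : ℕ) (hm : 2 ≤ k + c) :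
    (2 * ((k + c : ℕ) : ℚ) + 1) *
        ∑ j ∈ Finset.Icc k (k + c), (-1) ^ (k + j) * innerSum (k + c) j / (2 * j + 1) =
      (1 - 2 * c) * innerSum (k + c) k +
        2 * c * k.choose c * k.centralBinom / ((k + c : ℕ) * ((k + c : ℕ) - 1)) := by
  -- Descending induction on k with m = k + c fixed, from the single term k = m.
  induction c generalizing k with
  | zero =>
    have : 2 * (k : ℚ) + 1 ≠ 0 := by positivity
    simp [← two_mul]
    field_simp
  | succ c ih =>
    have ih' := ih (k + 1) (by omega)
    rw [show k + 1 + c = k + (c + 1) by ring] at ih'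
    rw [Finset.Icc_eq_cons_Ioc (by omega), Finset.sum_cons, ← Finset.Icc_add_one_left_eq_Ioc]
    have hs : ∑ j ∈ Finset.Icc (k + 1) (k + (c + 1)),
        (-1) ^ (k + j) * innerSum (k + (c + 1)) j / (2 * (j : ℚ) + 1) =
        -∑ j ∈ Finset.Icc (k + 1) (k + (c + 1)),
        (-1) ^ (k + 1 + j) * innerSum (k + (c + 1)) j / (2 * (j : ℚ) + 1) := by
      rw [← Finset.sum_neg_distrib]
      refine Finset.sum_congr rfl fun j _ => ?_
      ring
    rw [hs, mul_add, mul_neg, ih', Even.neg_one_pow ⟨k, rfl⟩]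
    have h1 := innerSum_succ k c
    have h2 : ((k + 1).centralBinom : ℚ) * (k + 1) = 2 * (2 * k + 1) * k.centralBinom := by
      have := Nat.succ_mul_centralBinom_succ k
      have h' : ((k : ℚ) + 1) * (k + 1).centralBinom = 2 * (2 * k + 1) * k.centralBinom := by
        exact_mod_cast this
      linear_combination h'
    have h3 : (k.choose (c + 1) : ℚ) * (c + 1) * (k + 1) =
        (k + 1).choose c * (k + 1 - c) * (k - c) := by
      have e1 := choose_succ_mul_sub k c
      have e2 := choose_succ_right_mul k c
      linear_combination (k + 1) * e2 - (k - c) * e1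
    have n1 : 2 * (k : ℚ) + 1 ≠ 0 := by positivity
    have n2 : (k : ℚ) + 1 ≠ 0 := by positivity
    have n3 : (k : ℚ) + (c + 1) ≠ 0 := by positivity
    have n4 : (k : ℚ) + c ≠ 0 := by
      have : 0 < k + c := by omega
      exact_mod_cast this.ne'
    -- Everything at k is rewritten through values at k+1, leaving a rational function identity.
    have h4 : (k.centralBinom : ℚ) = (k + 1).centralBinom * (k + 1) / (2 * (2 * k + 1)) := by
      rw [h2]; field_simp
    have h5 : (k.choose (c + 1) : ℚ) =
        (k + 1).choose c * (k + 1 - c) * (k - c) / ((c + 1) * (k + 1)) := by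
      rw [← h3]; field_simp
    have h6 : innerSum (k + (c + 1)) k = ((2 * k + 1) * (1 - 2 * c) *
        innerSum (k + (c + 1)) (k + 1) + ((k + 1).choose c : ℚ) * (k + 1).centralBinom) /
        (4 * (c + 1) * (k + 1)) := by
      rw [← h1]; field_simp
    rw [h4, h5, h6]
    push_cast
    rw [show (k : ℚ) + (c + 1) - 1 = k + c by ring]
    field_simp
    ring

/-! ### Integrality of the two remaining terms -/

lemma innerSum_mul_centralBinom (k c : ℕ) (hm : 2 ≤ k + c) :
    ∃ n : ℤ, innerSum (k + c) k * k.centralBinom = 2 * n := by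
  have key : ∀ i ∈ Finset.range (k + c + 1), ∃ n : ℤ,
      tripleChoose (k + c) k i / ((2 * i - 1) * (2 * (k + c : ℕ) - 2 * i - 1)) * k.centralBinom =
        2 * n := by
    intro i hi
    have him : i ≤ k + c := Nat.lt_succ_iff.1 (Finset.mem_range.1 hi)
    rw [tripleChoose, Nat.add_sub_cancel_left]
    rcases lt_or_ge k i with h1 | h1
    · exact ⟨0, by simp [Nat.choose_eq_zero_of_lt h1]⟩
    rcases lt_or_ge i c with h2 | h2
    · exact ⟨0, by simp [Nat.choose_eq_zero_of_lt h2]⟩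
    obtain ⟨b, rfl⟩ := Nat.exists_eq_add_of_le' h2
    obtain ⟨a, rfl⟩ := Nat.exists_eq_add_of_le' h1
    obtain ⟨n, hn⟩ := centralBinom_mul_dvd a b c
    -- m ≥ 2 keeps i and m-i from both being 0, which secures the factor 2.
    obtain ⟨n', hn'⟩ := two_mul_sub_one_mul_dvd_centralBinom_mul (b + c) (a + c) (by omega)
    have q1 := two_mul_sub_one_ne_zero (b + c)
    have q2 := two_mul_sub_one_ne_zero (a + c)
    refine ⟨n' * n, ?_⟩
    rw [show 2 * ((a + (b + c) + c : ℕ) : ℚ) - 2 * ((b + c : ℕ) : ℚ) - 1 =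
      2 * ((a + c : ℕ) : ℚ) - 1 by push_cast; ring, div_mul_eq_mul_div, div_eq_iff (mul_ne_zero q1 q2),
      show a + (b + c) + c = a + b + 2 * c by ring, ← add_assoc, hn, hn']
    push_cast
    ring
  choose! n hn using key
  refine ⟨∑ i ∈ Finset.range (k + c + 1), n i, ?_⟩
  rw [innerSum, Finset.sum_mul, Finset.sum_congr rfl hn]
  push_cast
  rw [Finset.mul_sum]

lemma choose_mul_centralBinom_div (k c : ℕ) (hm : 2 ≤ k + c) :
    ∃ n : ℤ, (c : ℚ) * k.choose c * k.centralBinom / ((k + c : ℕ) * ((k + c : ℕ) - 1)) = n := by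
  rcases lt_or_ge k c with h | h
  · exact ⟨0, by simp [Nat.choose_eq_zero_of_lt h]⟩
  rcases c with _ | c
  · exact ⟨0, by simp⟩
  obtain ⟨r, rfl⟩ := Nat.exists_eq_add_of_le h
  -- With A the numerator, the two products are A/(m-1) and A/m, and A/(m-1) - A/m = A/(m(m-1)).
  refine ⟨2 * (c + r + c).choose (c + r) * (c + r + c + 1 + r).choose (c + r + c + 1) -
    (c + r + c + 2 + r).choose (c + r + c + 2) * (c + r + 1 + c).choose (c + r + 1), ?_⟩
  push_cast
  rw [Nat.centralBinom_eq_two_mul_choose,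
    show 2 * (c + 1 + r) = c + 1 + r + (c + 1 + r) by ring]
  simp only [Nat.cast_add_choose]
  rw [show c + 1 + r + (c + 1 + r) = 2 * c + 2 * r + 1 + 1 by ring, show c + 1 + r = c + r + 1 by ring,
    show c + r + c + 1 + r = 2 * c + 2 * r + 1 by ring,
    show c + r + c + 2 + r = 2 * c + 2 * r + 1 + 1 by ring,
    show c + r + 1 + c = c + r + c + 1 by ring]
  simp only [Nat.factorial_succ]
  push_cast
  have n4 : (c : ℚ) + r + 1 + (c + 1) - 1 ≠ 0 := by
    rw [show (c : ℚ) + r + 1 + (c + 1) - 1 = c + r + 1 + c by ring]; positivity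
  have n5 : (c : ℚ) + 1 + r + (c + 1) - 1 ≠ 0 := by
    rw [show (c : ℚ) + 1 + r + (c + 1) - 1 = c + r + 1 + c by ring]; positivity
  field_simp
  ring

lemma explicitCoeff_eq (m k : ℕ) : explicitCoeff m k =
    3 / 2 * k.centralBinom *
      ∑ j ∈ Finset.Icc k m, (-1) ^ (k + j) * innerSum m j / (2 * (j : ℚ) + 1) := by
  rw [explicitCoeff, Finset.sum_comm, Finset.mul_sum, Nat.centralBinom_eq_two_mul_choose]
  refine Finset.sum_congr rfl fun j _ => ?_
  rw [innerSum, Finset.mul_sum, Finset.sum_div, Finset.mul_sum]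
  refine Finset.sum_congr rfl fun i _ => ?_
  simp only [tripleChoose, div_eq_mul_inv, mul_inv]
  ring

theorem three_dvd_mul_explicitCoeff (m k : ℕ) (hm : 2 ≤ m) :
    ∃ n : ℤ, (2 * (m : ℚ) + 1) * explicitCoeff m k = 3 * n := by
  rcases lt_or_ge m k with h | h
  · exact ⟨0, by simp [explicitCoeff_eq, Finset.Icc_eq_empty (not_le.2 h)]⟩
  obtain ⟨c, rfl⟩ := Nat.exists_eq_add_of_le h
  obtain ⟨n, hn⟩ := innerSum_mul_centralBinom k c hm
  obtain ⟨n', hn'⟩ := choose_mul_centralBinom_div k c hm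
  have h1 := alternating_sum_innerSum k c hm
  refine ⟨(1 - 2 * c) * n + n' * k.centralBinom, ?_⟩
  rw [explicitCoeff_eq, mul_left_comm, h1]
  push_cast at hn' ⊢
  rw [← hn']
  linear_combination 3 / 2 * (1 - 2 * (c : ℚ)) * hn

end KevinPoly

theorem mainTheorem2 (m k : ℤ) :
    ∃ n : ℤ, (m : ℚ) * ((m : ℚ) - 1) * (2 * (m : ℚ) + 1) * KevinPoly.d m k =
      (n : ℚ) * (3 * (m : ℚ) * ((m : ℚ) - 1)) := by
  by_cases h : 0 ≤ m ∧ 0 ≤ k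
  · obtain ⟨hm, hk⟩ := h
    lift m to ℕ using hm
    lift k to ℕ using hk
    rcases lt_or_ge m 2 with h2 | h2
    · exact ⟨0, by interval_cases m <;> simp⟩
    · obtain ⟨n, hn⟩ := KevinPoly.three_dvd_mul_explicitCoeff m k h2
      refine ⟨n, ?_⟩
      rw [KevinPoly.d_natCast]
      push_cast
      linear_combination (m : ℚ) * ((m : ℚ) - 1) * hn
  · exact ⟨0, by simp [KevinPoly.d, h]⟩
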